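/- For a polynomial $p$ and a bounded non-empty set $I\subset\mathbb R$ put $\|p\|_I=\sup_{x\in I}|p(x)|$. The monic integer transfinite diameter of a closed interval $I$ is $$t_M(I)=\lim_{m\to\infty}\ \inf\bigl\{\|p\|_I^{1/m} : p\in\mathbb Z[x]\text{ monic of degree } m\bigr\},$$ and for an integer $n>1$ let $$b_{\max}(n)=\sup\bigl\{b>\tfrac1n : t_M([0,b])=\tfrac1n\bigr\}.$$ An obstruction for $I$ is a number $a_d^{-1/d}$, where $q=a_dx^d+\dots+a_0$ is irreducible in $\mathbb Z[x]$, $d\ge 1$, $a_d>1$, and all complex roots of $q$ lie in $I$. The largest obstruction, if there is one, is the maximal obstruction $m(I)$, and a monic $P\in\mathbb Z[x]$ of degree $N\ge1$ attains it if $\|P\|_I=m(I)^N$. Let $$\begin{aligned} P_3={}&x^{45944640}(x^{14}-11406261x^{13}+47054086x^{12}-88456310x^{11}+100247244x^{10}-76341256x^9\\ &\quad+41208853x^8-16202606x^7+4692047x^6-999261x^5+154318x^4-16766x^3+1211x^2-52x+1)^{2450525}\\ &\cdot(x^8+14184x^7-34944x^6+36442x^5-20832x^4+7041x^3-1405x^2+153x-7)^{877415}\\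 &\cdot(x^8+4842x^7-10935x^6+10355x^5-5317x^4+1594x^3-278x^2+26x-1)^{2571030}\\ &\cdot(x^8+7812x^7-18072x^6+17561x^5-9271x^4+2864x^3-516x^2+50x-2)^{595980}\\ &\cdot(x^7-1233x^6+2406x^5-1913x^4+791x^3-179x^2+21x-1)^{1210840}\\ &\cdot(x^5-3x^4+7x^3-11x^2+6x-1)^{1052898},\\ P_4={}&x^{640}(x^5+432x^4-456x^3+179x^2-31x+2)^{47}\\ &\cdot(x^7+8760x^6-13342x^5+8388x^4-2784x^3+514x^2-50x+2)^{35},\\ P_5={}&x^{1050990}(x^{10}+5544095x^9-9115714x^8+6623719x^7-2790988x^6+751349x^5\\ &\quad-133974x^4+15818x^3-1192x^2+52x-1)^{78796}\\ &\cdot(x^6+4950x^5-4605x^4+1698x^3-310x^2+28x-1)^{21825},\\ P_6={}&x^{5232473}(x^5+1260x^4-852x^3+215x^2-24x+1)^{118824}\\ &\cdot(x^7-140190x^6+132517x^5-51966x^4+10819x^3-1261x^2+78x-2)^{200917},\\ P_7={}&x^{44}(x^5+3472x^4-1826x^3+358x^2-31x+1),\\ P_8={}&x^{12288}(x^2-8x+1)^{246}(x^4-576x^3+208x^2-25x+1)^{741},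 \end{aligned}$$ and $b_3=0.465$, $b_4=0.303$, $b_5=0.230$, $b_6=0.184$, $b_7=0.148$, $b_8=0.130$. Then for each $n\in\{3,\dots,8\}$ the number $\frac1n$ is the maximal obstruction for $[0,b_n)$ and the monic polynomial $P_n$ attains it: $\|P_n\|_{[0,b_n)}=n^{-\deg P_n}$. Moreover $$b_{\max}(3)\ge0.465,\quad b_{\max}(4)\ge0.303,\quad b_{\max}(5)\ge0.230,\quad b_{\max}(6)\ge0.184,\quad b_{\max}(7)\ge0.148,\quad b_{\max}(8)\ge0.130.$$ -/

import Mathlib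

open Filter Topology Polynomial

namespace MonicDiameter

/-- The supremum norm `‖p‖_I = sup_{x ∈ I} |p(x)|` of an integer polynomial on a real set
(used only for bounded non-empty `I`). -/
noncomputable def supNorm (p : ℤ[X]) (I : Set ℝ) : ℝ :=
  sSup ((fun x : ℝ => |aeval x p|) '' I)

/-- `inf ‖p‖_I^{1/m}` over the monic integer polynomials `p` of degree `m`. -/
noncomputable def minNorm (I : Set ℝ) (m : ℕ) : ℝ :=
  sInf {t : ℝ | ∃ p : ℤ[X], p.Monic ∧ p.natDegree = m ∧ t = supNorm p I ^ (1 / (m : ℝ))}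

/-- `t_M(I) = t`: the limit defining the monic integer transfinite diameter of `I` exists and
equals `t`. -/
def HasMonicTransfiniteDiameter (I : Set ℝ) (t : ℝ) : Prop :=
  Tendsto (fun m : ℕ => minNorm I m) atTop (𝓝 t)

/-- `b_max(n)`: the supremum of the `b > 1/n` such that `t_M([0,b]) = 1/n`. -/
noncomputable def bMax (n : ℕ) : ℝ :=
  sSup {b : ℝ | 1 / (n : ℝ) < b ∧ HasMonicTransfiniteDiameter (Set.Icc 0 b) (1 / (n : ℝ))}

/-- `c` is an obstruction for `I`: `c = a_d^{-1/d}` for some irreducible integer polynomial of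
degree `d ≥ 1` with leading coefficient `a_d > 1` and all of its complex roots in `I`. -/
def IsObstruction (I : Set ℝ) (c : ℝ) : Prop :=
  ∃ q : ℤ[X], Irreducible q ∧ 0 < q.natDegree ∧ 1 < q.leadingCoeff ∧
    (∀ z : ℂ, aeval z q = 0 → ∃ x ∈ I, (x : ℂ) = z) ∧
    c = (q.leadingCoeff : ℝ) ^ (-(1 / (q.natDegree : ℝ)))

/-- `c` is the maximal obstruction for `I`. -/
def IsMaximalObstruction (I : Set ℝ) (c : ℝ) : Prop :=
  IsGreatest {c : ℝ | IsObstruction I c} c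

/-- The non-constant monic polynomial `p` attains the maximal obstruction for `I`, and this
maximal obstruction is `c`. -/
def AttainsMaximalObstruction (p : ℤ[X]) (I : Set ℝ) (c : ℝ) : Prop :=
  p.Monic ∧ 0 < p.natDegree ∧ IsMaximalObstruction I c ∧ supNorm p I = c ^ p.natDegree

noncomputable def P3 : ℤ[X] :=
  X ^ 45944640 *
  (X ^ 14 - 11406261 * X ^ 13 + 47054086 * X ^ 12 - 88456310 * X ^ 11 + 100247244 * X ^ 10
    - 76341256 * X ^ 9 + 41208853 * X ^ 8 - 16202606 * X ^ 7 + 4692047 * X ^ 6 - 999261 * X ^ 5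
    + 154318 * X ^ 4 - 16766 * X ^ 3 + 1211 * X ^ 2 - 52 * X + 1) ^ 2450525 *
  (X ^ 8 + 14184 * X ^ 7 - 34944 * X ^ 6 + 36442 * X ^ 5 - 20832 * X ^ 4 + 7041 * X ^ 3
    - 1405 * X ^ 2 + 153 * X - 7) ^ 877415 *
  (X ^ 8 + 4842 * X ^ 7 - 10935 * X ^ 6 + 10355 * X ^ 5 - 5317 * X ^ 4 + 1594 * X ^ 3
    - 278 * X ^ 2 + 26 * X - 1) ^ 2571030 *
  (X ^ 8 + 7812 * X ^ 7 - 18072 * X ^ 6 + 17561 * X ^ 5 - 9271 * X ^ 4 + 2864 * X ^ 3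
    - 516 * X ^ 2 + 50 * X - 2) ^ 595980 *
  (X ^ 7 - 1233 * X ^ 6 + 2406 * X ^ 5 - 1913 * X ^ 4 + 791 * X ^ 3 - 179 * X ^ 2
    + 21 * X - 1) ^ 1210840 *
  (X ^ 5 - 3 * X ^ 4 + 7 * X ^ 3 - 11 * X ^ 2 + 6 * X - 1) ^ 1052898

noncomputable def P4 : ℤ[X] :=
  X ^ 640 *
  (X ^ 5 + 432 * X ^ 4 - 456 * X ^ 3 + 179 * X ^ 2 - 31 * X + 2) ^ 47 *
  (X ^ 7 + 8760 * X ^ 6 - 13342 * X ^ 5 + 8388 * X ^ 4 - 2784 * X ^ 3 + 514 * X ^ 2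
    - 50 * X + 2) ^ 35

noncomputable def P5 : ℤ[X] :=
  X ^ 1050990 *
  (X ^ 10 + 5544095 * X ^ 9 - 9115714 * X ^ 8 + 6623719 * X ^ 7 - 2790988 * X ^ 6
    + 751349 * X ^ 5 - 133974 * X ^ 4 + 15818 * X ^ 3 - 1192 * X ^ 2 + 52 * X - 1) ^ 78796 *
  (X ^ 6 + 4950 * X ^ 5 - 4605 * X ^ 4 + 1698 * X ^ 3 - 310 * X ^ 2 + 28 * X - 1) ^ 21825

noncomputable def P6 : ℤ[X] :=
  X ^ 5232473 *
  (X ^ 5 + 1260 * X ^ 4 - 852 * X ^ 3 + 215 * X ^ 2 - 24 * X + 1) ^ 118824 *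
  (X ^ 7 - 140190 * X ^ 6 + 132517 * X ^ 5 - 51966 * X ^ 4 + 10819 * X ^ 3 - 1261 * X ^ 2
    + 78 * X - 2) ^ 200917

noncomputable def P7 : ℤ[X] :=
  X ^ 44 * (X ^ 5 + 3472 * X ^ 4 - 1826 * X ^ 3 + 358 * X ^ 2 - 31 * X + 1)

noncomputable def P8 : ℤ[X] :=
  X ^ 12288 *
  (X ^ 2 - 8 * X + 1) ^ 246 *
  (X ^ 4 - 576 * X ^ 3 + 208 * X ^ 2 - 25 * X + 1) ^ 741

end MonicDiameter

namespace MonicDiameter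

/-! Lower bounds come from resultants. If `q` is irreducible of degree d with leading coefficient a
> 1 and all its roots in I, and p is monic of degree N, then Res(q, p) is a nonzero integer equal to
a^N times the product of p over the roots of q, so 1 ≤ a^N ‖p‖_I^d. For q = n x - 1 this gives ‖p‖_I
≥ n^(-N) as soon as 1/n lies in I. Hence a single monic p with |p| ≤ n^(-N) on [0, b] settles
everything for n. The same inequality shows that no obstruction exceeds 1/n. The products p^k x^r
with r < N have every degree and stay near the bound, so t_M([0, b]) = 1/n, whence b ≤ b_max(n).

It remains to check |P_n| ≤ n^(-N) on [0, b_n], that is, Σ eᵢ log |n^dᵢ qᵢ(x)| ≤ 0 for the factors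
qᵢ^eᵢ of P_n, where dᵢ = deg qᵢ. Equality holds at x = 1/n, where n^dᵢ qᵢ(1/n) = ±1 for every
factor. There the exponents make the first-order terms in u = n x - 1 cancel exactly, and the sign
is decided at second order (`logNorm_nonpos_of_localCheck`). Away from 1/n the interval is bisected,
and on each piece the sum is bounded in integer arithmetic (`logNorm_nonpos_of_intervalCheck`).
Polynomial parts are added over all factors before absolute values are taken, so that cancellation
between factors is not lost. -/

/-! ### The resultant inequality. -/

/-- A leading coefficient greater than 1 prevents `q` from dividing the monic `p`; by Gauss's lemma
the two are coprime over ℚ, so their resultant is a nonzero integer, of absolute value at least 1.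
-/
theorem one_le_leadingCoeff_pow_mul {p q : ℤ[X]} (hp : p.Monic) (hq : Irreducible q)
    (hd : 0 < q.natDegree) (ha : 1 < q.leadingCoeff) {I : Set ℝ}
    (hroots : ∀ z : ℂ, aeval z q = 0 → ∃ x ∈ I, (x : ℂ) = z) {B : ℝ}
    (hB : ∀ x ∈ I, |aeval x p| ≤ B) :
    1 ≤ (q.leadingCoeff : ℝ) ^ p.natDegree * B ^ q.natDegree := by
  have hndvd : ¬ q ∣ p := by
    rintro ⟨r, hr⟩
    have h1 : q.leadingCoeff * r.leadingCoeff = 1 := by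
      rw [← leadingCoeff_mul, ← hr, hp.leadingCoeff]
    have := Int.eq_one_or_neg_one_of_mul_eq_one h1
    omega
  have hprim : q.IsPrimitive := hq.isPrimitive hd.ne'
  have hcop : IsCoprime (q.map (Int.castRingHom ℚ)) (p.map (Int.castRingHom ℚ)) := by
    refine (Irreducible.coprime_iff_not_dvd
      ((IsPrimitive.Int.irreducible_iff_irreducible_map_cast hprim).1 hq)).2 ?_
    rwa [← IsPrimitive.Int.dvd_iff_map_cast_dvd_map_cast _ _ hprim]
  have hres : resultant q p ≠ 0 := by
    have h := resultant_ne_zero _ _ hcop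
    rw [natDegree_map_eq_of_injective (RingHom.injective_int _),
      natDegree_map_eq_of_injective (RingHom.injective_int _), resultant_map_map] at h
    exact fun h0 => h (by rw [h0, map_zero])
  set f := Int.castRingHom ℂ
  have hf : f = algebraMap ℤ ℂ := (algebraMap_int_eq ℂ).symm
  have hsplit : (q.map f).Splits := IsAlgClosed.splits _
  have hnat : (q.map f).natDegree = q.natDegree :=
    natDegree_map_eq_of_injective (RingHom.injective_int _) _
  have hlc : (q.map f).leadingCoeff = (q.leadingCoeff : ℂ) := by
    rw [leadingCoeff_map_of_injective (RingHom.injective_int _)]; rfl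
  have hprod := resultant_eq_prod_eval (q.map f) (p.map f) p.natDegree natDegree_map_le hsplit
  rw [hnat, resultant_map_map, hlc] at hprod
  have hnorm : (1 : ℝ) ≤ ‖f (resultant q p)‖ := by
    have : ‖f (resultant q p)‖ = |((resultant q p : ℤ) : ℝ)| := by
      simp [f]
    rw [this]
    exact_mod_cast Int.one_le_abs hres
  rw [hprod, norm_mul, norm_pow, Complex.norm_intCast,
    abs_of_pos (by exact_mod_cast (zero_lt_one.trans ha))] at hnorm
  refine hnorm.trans (mul_le_mul_of_nonneg_left ?_ (by positivity))
  have hcard : (q.map f).roots.card = q.natDegree := by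
    rw [← hsplit.natDegree_eq_card_roots, hnat]
  have hbound : ∀ z ∈ (q.map f).roots, ‖(p.map f).eval z‖ ≤ B := by
    intro z hz
    have hz0 : aeval z q = 0 := by
      have := (mem_roots'.1 hz).2
      rwa [IsRoot.def, eval_map, hf, ← aeval_def] at this
    obtain ⟨x, hx, rfl⟩ := hroots z hz0
    have h1 : (p.map f).eval (x : ℂ) = ((aeval x p : ℝ) : ℂ) := by
      rw [eval_map, hf, ← aeval_def]
      exact (aeval_algebraMap_apply ℂ x p)
    rw [h1, Complex.norm_real]
    exact hB x hx
  rw [← hcard]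
  -- Only the bound on each element matters from here on, so the roots become an arbitrary multiset
  -- and induction applies.
  generalize (q.map f).roots = s at hbound
  induction s using Multiset.induction_on with
  | empty => simp
  | cons z s ih =>
    rw [Multiset.map_cons, Multiset.prod_cons, norm_mul, Multiset.card_cons, pow_succ, mul_comm]
    have h0 := hbound z (Multiset.mem_cons_self z s)
    exact mul_le_mul (ih fun w hw => hbound w (Multiset.mem_cons_of_mem hw)) h0 (norm_nonneg _)
      (pow_nonneg ((norm_nonneg _).trans h0) _)

/-! ### The obstruction 1/n and its maximality. -/

/-- The linear polynomial `n x - 1`. -/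
noncomputable def linearPoly (n : ℕ) : ℤ[X] := C (n : ℤ) * X + C (-1)

theorem linearPoly_natDegree {n : ℕ} (hn : 1 < n) : (linearPoly n).natDegree = 1 :=
  natDegree_linear (by exact_mod_cast (by omega : n ≠ 0))

theorem linearPoly_leadingCoeff {n : ℕ} (hn : 1 < n) : (linearPoly n).leadingCoeff = n :=
  leadingCoeff_linear (by exact_mod_cast (by omega : n ≠ 0))

theorem linearPoly_irreducible {n : ℕ} (hn : 1 < n) : Irreducible (linearPoly n) :=
  irreducible_C_mul_X_add_C (by exact_mod_cast (by omega : n ≠ 0))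
    (isUnit_neg_one.isRelPrime_right)

theorem linearPoly_roots {n : ℕ} (hn : 1 < n) {I : Set ℝ} (hI : 1 / (n : ℝ) ∈ I) (z : ℂ)
    (hz : aeval z (linearPoly n) = 0) : ∃ x ∈ I, (x : ℂ) = z := by
  refine ⟨_, hI, ?_⟩
  have h0 : (n : ℂ) ≠ 0 := by exact_mod_cast (by omega : n ≠ 0)
  simp [linearPoly] at hz
  push_cast
  field_simp
  linear_combination -hz

theorem one_le_pow_mul {n : ℕ} (hn : 1 < n) {p : ℤ[X]} (hp : p.Monic) {I : Set ℝ}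
    (hI : 1 / (n : ℝ) ∈ I) {B : ℝ} (hB : ∀ x ∈ I, |aeval x p| ≤ B) :
    1 ≤ (n : ℝ) ^ p.natDegree * B := by
  have := one_le_leadingCoeff_pow_mul hp (linearPoly_irreducible hn)
    (by rw [linearPoly_natDegree hn]; exact one_pos)
    (by rw [linearPoly_leadingCoeff hn]; exact_mod_cast hn) (linearPoly_roots hn hI) hB
  rwa [linearPoly_natDegree hn, linearPoly_leadingCoeff hn, pow_one, Int.cast_natCast] at this

theorem abs_aeval_le_supNorm {p : ℤ[X]} {I : Set ℝ} {a b : ℝ} (hI : I ⊆ Set.Icc a b) {x : ℝ}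
    (hx : x ∈ I) : |aeval x p| ≤ supNorm p I := by
  have hc : Continuous fun x : ℝ => |aeval x p| := (Polynomial.continuous_aeval p).abs
  exact le_csSup (((isCompact_Icc.image hc).bddAbove).mono (Set.image_mono hI))
    (Set.mem_image_of_mem _ hx)

theorem supNorm_le {p : ℤ[X]} {I : Set ℝ} (hne : I.Nonempty) {B : ℝ}
    (hB : ∀ x ∈ I, |aeval x p| ≤ B) : supNorm p I ≤ B :=
  csSup_le (hne.image _) (by rintro _ ⟨x, hx, rfl⟩; exact hB x hx)

theorem supNorm_nonneg (p : ℤ[X]) (I : Set ℝ) : 0 ≤ supNorm p I :=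
  Real.sSup_nonneg (by rintro _ ⟨x, -, rfl⟩; exact abs_nonneg _)

theorem inv_pow_le_supNorm {n : ℕ} (hn : 1 < n) {p : ℤ[X]} (hp : p.Monic) {I : Set ℝ} {a b : ℝ}
    (hIab : I ⊆ Set.Icc a b) (hI : 1 / (n : ℝ) ∈ I) :
    (1 / (n : ℝ)) ^ p.natDegree ≤ supNorm p I := by
  have h := one_le_pow_mul hn hp hI fun x hx => abs_aeval_le_supNorm (p := p) hIab hx
  have h0 : (0 : ℝ) < n := by exact_mod_cast (by omega : 0 < n)
  rw [div_pow, one_pow, div_le_iff₀ (by positivity)]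
  linarith

/-- The value 1/n comes from n x - 1. For a competitor with leading coefficient a and degree d, the
resultant inequality reads 1 ≤ (a n^(-d))^N with N > 0, which forces a ≥ n^d. -/
theorem isMaximalObstruction_one_div {n : ℕ} (hn : 1 < n) {p : ℤ[X]} (hp : p.Monic)
    (hdeg : 0 < p.natDegree) {I : Set ℝ} (hI : 1 / (n : ℝ) ∈ I)
    (hB : ∀ x ∈ I, |aeval x p| ≤ (1 / (n : ℝ)) ^ p.natDegree) :
    IsMaximalObstruction I (1 / (n : ℝ)) := by
  have h0 : (0 : ℝ) < n := by exact_mod_cast (by omega : 0 < n)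
  constructor
  · refine ⟨linearPoly n, linearPoly_irreducible hn, ?_, ?_, linearPoly_roots hn hI, ?_⟩
    · rw [linearPoly_natDegree hn]; exact one_pos
    · rw [linearPoly_leadingCoeff hn]; exact_mod_cast hn
    · rw [linearPoly_natDegree hn, linearPoly_leadingCoeff hn]
      simp [Real.rpow_neg_one]
  · rintro c ⟨q, hq, hd, ha, hroots, rfl⟩
    have h := one_le_leadingCoeff_pow_mul hp hq hd ha hroots hB
    have ha0 : (0 : ℝ) < q.leadingCoeff := by exact_mod_cast zero_lt_one.trans ha
    rw [pow_right_comm, ← mul_pow] at h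
    have h1 : 1 ≤ (q.leadingCoeff : ℝ) * (1 / (n : ℝ)) ^ q.natDegree := by
      by_contra hlt
      exact absurd h (not_le.2 (pow_lt_one₀ (by positivity) (not_le.1 hlt) hdeg.ne'))
    have hd0 : (0 : ℝ) < q.natDegree := by exact_mod_cast hd
    have h2 : (n : ℝ) ^ q.natDegree ≤ q.leadingCoeff := by
      rw [div_pow, one_pow, mul_one_div, le_div_iff₀ (by positivity), one_mul] at h1
      exact h1
    have h3 : (n : ℝ) ≤ (q.leadingCoeff : ℝ) ^ (1 / (q.natDegree : ℝ)) := by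
      calc (n : ℝ) = ((n : ℝ) ^ q.natDegree) ^ (1 / (q.natDegree : ℝ)) := by
            rw [one_div, Real.pow_rpow_inv_natCast h0.le hd.ne']
        _ ≤ _ := Real.rpow_le_rpow (by positivity) h2 (by positivity)
    rw [Real.rpow_neg ha0.le, ← one_div]
    exact one_div_le_one_div_of_le h0 h3

theorem attainsMaximalObstruction_of_forall_le {n : ℕ} (hn : 1 < n) {p : ℤ[X]} (hp : p.Monic)
    (hdeg : 0 < p.natDegree) {b : ℝ} (hb : 1 / (n : ℝ) < b)
    (hB : ∀ x ∈ Set.Icc 0 b, |aeval x p| ≤ (1 / (n : ℝ)) ^ p.natDegree) :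
    AttainsMaximalObstruction p (Set.Ico 0 b) (1 / (n : ℝ)) := by
  have hI : 1 / (n : ℝ) ∈ Set.Ico 0 b := ⟨by positivity, hb⟩
  have hB' := fun x hx => hB x (Set.Ico_subset_Icc_self hx)
  exact ⟨hp, hdeg, isMaximalObstruction_one_div hn hp hdeg hI hB',
    (supNorm_le ⟨_, hI⟩ hB').antisymm (inv_pow_le_supNorm hn hp Set.Ico_subset_Icc_self hI)⟩

/-! ### The transfinite diameter and `bMax`. -/

theorem one_div_le_minNorm {n : ℕ} (hn : 1 < n) {I : Set ℝ} {a b : ℝ}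
    (hIab : I ⊆ Set.Icc a b) (hI : 1 / (n : ℝ) ∈ I) {m : ℕ} (hm : 0 < m) :
    1 / (n : ℝ) ≤ minNorm I m := by
  refine le_csInf ⟨_, X ^ m, monic_X_pow m, natDegree_X_pow m, rfl⟩ ?_
  rintro _ ⟨p, hp, rfl, rfl⟩
  calc 1 / (n : ℝ) = ((1 / (n : ℝ)) ^ p.natDegree) ^ (1 / (p.natDegree : ℝ)) := by
        rw [one_div (p.natDegree : ℝ), Real.pow_rpow_inv_natCast (by positivity) hm.ne']
    _ ≤ _ := Real.rpow_le_rpow (by positivity) (inv_pow_le_supNorm hn hp hIab hI) (by positivity)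

/-- The competitor is p^(m / N) x^(m % N), with N the degree of p. Since b ≤ 1 the power of x costs
nothing, and N ⌊m/N⌋ ≥ m - N gives the exponent. -/
theorem minNorm_le_rpow {n : ℕ} (hn : 1 < n) {p : ℤ[X]} (hp : p.Monic)
    (hdeg : 0 < p.natDegree) {b : ℝ} (hb : 0 ≤ b) (hb1 : b ≤ 1)
    (hB : ∀ x ∈ Set.Icc 0 b, |aeval x p| ≤ (1 / (n : ℝ)) ^ p.natDegree) {m : ℕ} (hm : 0 < m) :
    minNorm (Set.Icc 0 b) m ≤ (n : ℝ) ^ (-1 + (p.natDegree : ℝ) / m) := by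
  set N := p.natDegree with hN
  have h0 : (0 : ℝ) < n := by exact_mod_cast (by omega : 0 < n)
  have hmon : (p ^ (m / N) * X ^ (m % N)).Monic := (hp.pow _).mul (monic_X_pow _)
  have hnat : (p ^ (m / N) * X ^ (m % N)).natDegree = m := by
    rw [(hp.pow _).natDegree_mul (monic_X_pow _), hp.natDegree_pow, natDegree_X_pow, ← hN,
      mul_comm]
    exact Nat.div_add_mod m N
  have hle : supNorm (p ^ (m / N) * X ^ (m % N)) (Set.Icc 0 b) ≤
      ((1 / (n : ℝ)) ^ N) ^ (m / N) := by
    refine supNorm_le (Set.nonempty_Icc.2 hb) fun x hx => ?_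
    rw [map_mul, map_pow, map_pow, aeval_X, abs_mul, abs_pow, abs_pow]
    have hx1 : |x| ^ (m % N) ≤ 1 :=
      pow_le_one₀ (abs_nonneg _) (by rw [abs_of_nonneg hx.1]; exact hx.2.trans hb1)
    calc _ ≤ ((1 / (n : ℝ)) ^ N) ^ (m / N) * 1 :=
          mul_le_mul (pow_le_pow_left₀ (abs_nonneg _) (hB x hx) _) hx1 (by positivity)
            (by positivity)
      _ = _ := mul_one _
  have hmin : minNorm (Set.Icc 0 b) m ≤
      supNorm (p ^ (m / N) * X ^ (m % N)) (Set.Icc 0 b) ^ (1 / (m : ℝ)) := by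
    apply csInf_le
    · refine ⟨0, ?_⟩
      rintro _ ⟨q, -, -, rfl⟩
      exact Real.rpow_nonneg (supNorm_nonneg _ _) _
    · exact ⟨_, hmon, hnat, rfl⟩
  · refine (hmin.trans (Real.rpow_le_rpow (supNorm_nonneg _ _) hle (by positivity))).trans ?_
    rw [← pow_mul, one_div, inv_pow, ← Real.rpow_natCast, ← Real.rpow_neg h0.le,
      ← Real.rpow_mul h0.le]
    refine Real.rpow_le_rpow_of_exponent_le (by exact_mod_cast hn.le) ?_
    have hm0 : (0 : ℝ) < m := by exact_mod_cast hm
    have h1 : m ≤ N * (m / N) + N := by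
      have := Nat.div_add_mod m N
      have := Nat.mod_lt m hdeg
      omega
    have h2 : (m : ℝ) ≤ ((N * (m / N) : ℕ) : ℝ) + N := by exact_mod_cast h1
    rw [mul_one_div, div_le_iff₀ hm0]
    field_simp
    linarith

theorem hasMonicTransfiniteDiameter_of_forall_le {n : ℕ} (hn : 1 < n) {p : ℤ[X]} (hp : p.Monic)
    (hdeg : 0 < p.natDegree) {b : ℝ} (hb : 1 / (n : ℝ) < b) (hb1 : b ≤ 1)
    (hB : ∀ x ∈ Set.Icc 0 b, |aeval x p| ≤ (1 / (n : ℝ)) ^ p.natDegree) :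
    HasMonicTransfiniteDiameter (Set.Icc 0 b) (1 / (n : ℝ)) := by
  have h0 : (0 : ℝ) < n := by exact_mod_cast (by omega : 0 < n)
  have hI : 1 / (n : ℝ) ∈ Set.Icc 0 b := ⟨by positivity, hb.le⟩
  have hlim : Tendsto (fun m : ℕ => (n : ℝ) ^ (-1 + (p.natDegree : ℝ) / m)) atTop
      (𝓝 (1 / (n : ℝ))) := by
    have h1 : Tendsto (fun m : ℕ => -1 + (p.natDegree : ℝ) / m) atTop (𝓝 (-1 + 0)) :=
      tendsto_const_nhds.add (tendsto_const_div_atTop_nhds_zero_nat _)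
    have h2 := (Real.continuousAt_const_rpow (b := -1 + 0) h0.ne').tendsto.comp h1
    rwa [add_zero, Real.rpow_neg_one, ← one_div] at h2
  refine tendsto_of_tendsto_of_tendsto_of_le_of_le' tendsto_const_nhds hlim ?_ ?_
  · filter_upwards [eventually_gt_atTop 0] with m hm
    exact one_div_le_minNorm hn subset_rfl hI hm
  · filter_upwards [eventually_gt_atTop 0] with m hm
    exact minNorm_le_rpow hn hp hdeg (hI.1.trans hI.2) hb1 hB hm

/-- For b > 1 the point 1/(n - 1) also lies in [0, b], and since n - 1 > 1 it forces the limit to be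
at least 1/(n - 1) > 1/n. Boundedness is essential: the real `sSup` of an unbounded set is 0. -/
theorem bddAbove_hasMonicTransfiniteDiameter {n : ℕ} (hn : 2 < n) :
    BddAbove {b : ℝ | 1 / (n : ℝ) < b ∧
      HasMonicTransfiniteDiameter (Set.Icc 0 b) (1 / (n : ℝ))} := by
  refine ⟨1, ?_⟩
  rintro b ⟨-, hlim⟩
  by_contra! hb
  have hn1 : 1 < n - 1 := by omega
  have h1 : (0 : ℝ) < (n - 1 : ℕ) := by exact_mod_cast (by omega : 0 < n - 1)
  have hI : 1 / ((n - 1 : ℕ) : ℝ) ∈ Set.Icc 0 b := by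
    refine ⟨by positivity, le_trans ?_ hb.le⟩
    rw [div_le_one h1]
    exact_mod_cast hn1.le
  have hle : 1 / ((n - 1 : ℕ) : ℝ) ≤ 1 / (n : ℝ) := by
    refine ge_of_tendsto hlim ?_
    filter_upwards [eventually_gt_atTop 0] with m hm
    exact one_div_le_minNorm hn1 subset_rfl hI hm
  have hlt : 1 / (n : ℝ) < 1 / ((n - 1 : ℕ) : ℝ) :=
    one_div_lt_one_div_of_lt h1 (by exact_mod_cast (by omega : n - 1 < n))
  exact absurd hle (not_le.2 hlt)

theorem le_bMax_of_forall_le {n : ℕ} (hn : 2 < n) {p : ℤ[X]} (hp : p.Monic)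
    (hdeg : 0 < p.natDegree) {b : ℝ} (hb : 1 / (n : ℝ) < b) (hb1 : b ≤ 1)
    (hB : ∀ x ∈ Set.Icc 0 b, |aeval x p| ≤ (1 / (n : ℝ)) ^ p.natDegree) : b ≤ bMax n :=
  le_csSup (bddAbove_hasMonicTransfiniteDiameter hn)
    ⟨hb, hasMonicTransfiniteDiameter_of_forall_le (by omega) hp hdeg hb hb1 hB⟩

/-! ### Polynomials as integer coefficient lists. -/

/-- The value at `x` of the polynomial with coefficient list `l`, constant coefficient first. -/
def evalList : List ℤ → ℝ → ℝ
  | [], _ => 0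
  | c :: l, x => c + x * evalList l x

/-- The polynomial with coefficient list `l`, constant coefficient first. -/
noncomputable def toPoly : List ℤ → ℤ[X]
  | [] => 0
  | c :: l => C c + X * toPoly l

/-- The product of the powers `toPoly l ^ e` over the pairs `(e, l)`. -/
noncomputable def prodPoly : List (ℕ × List ℤ) → ℤ[X]
  | [] => 1
  | f :: fs => prodPoly fs * toPoly f.2 ^ f.1

/-- The degree of `prodPoly fs` if all factors are monic. -/
def degSum : List (ℕ × List ℤ) → ℕ
  | [] => 0
  | f :: fs => f.1 * (f.2.length - 1) + degSum fs

theorem aeval_toPoly (l : List ℤ) (x : ℝ) : aeval x (toPoly l) = evalList l x := by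
  induction l with
  | nil => simp [toPoly, evalList]
  | cons c l ih => simp [toPoly, evalList, ih]

theorem toPoly_monic_natDegree {l : List ℤ} (hl : l.getLast? = some 1) :
    (toPoly l).Monic ∧ (toPoly l).natDegree = l.length - 1 := by
  induction l with
  | nil => simp at hl
  | cons c l ih =>
    cases l with
    | nil => simp_all [toPoly]
    | cons d l =>
      obtain ⟨h1, h2⟩ := ih (by simpa using hl)
      have h3 : (X * toPoly (d :: l)).Monic := monic_X.mul h1
      have h4 : (X * toPoly (d :: l)).natDegree = l.length + 1 := by
        rw [monic_X.natDegree_mul h1, h2, natDegree_X, List.length_cons]; omega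
      have h5 : (C c).degree < (X * toPoly (d :: l)).degree := by
        rw [degree_eq_natDegree h3.ne_zero, h4]
        exact degree_C_le.trans_lt (by exact_mod_cast Nat.succ_pos _)
      rw [toPoly]
      refine ⟨h3.add_of_right h5, ?_⟩
      rw [natDegree_add_eq_right_of_degree_lt h5, h4]
      rfl

theorem prodPoly_monic_natDegree {fs : List (ℕ × List ℤ)}
    (hfs : ∀ f ∈ fs, f.2.getLast? = some 1) :
    (prodPoly fs).Monic ∧ (prodPoly fs).natDegree = degSum fs := by
  induction fs with
  | nil => simp [prodPoly, degSum]
  | cons f fs ih =>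
    obtain ⟨h1, h2⟩ := ih fun g hg => hfs g (List.mem_cons_of_mem _ hg)
    obtain ⟨h3, h4⟩ := toPoly_monic_natDegree (hfs f List.mem_cons_self)
    rw [prodPoly]
    refine ⟨h1.mul (h3.pow _), ?_⟩
    rw [h1.natDegree_mul (h3.pow _), h3.natDegree_pow, h4, h2, degSum, add_comm]

/-! ### Denominator-free Taylor expansion. -/

/-- The coefficients of `c + m (a + u) s(u)` as a polynomial in `u`. -/
def taylorCons (a m c : ℤ) : List ℤ → List ℤ
  | [] => [c]
  | s :: t => (c + m * a * s) :: taylorCons a m (m * s) t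

/-- With s(u) = s₀ + u t(u), the right side is (c + m a s₀) + u (m s₀ + m (a + u) t(u)), so the
recursion carries m s₀ as its next constant. -/
theorem evalList_taylorCons (a m c : ℤ) (s : List ℤ) (u : ℝ) :
    evalList (taylorCons a m c s) u = c + m * (a + u) * evalList s u := by
  induction s generalizing c with
  | nil => simp [taylorCons, evalList]
  | cons s t ih => simp only [taylorCons, evalList, ih]; push_cast; ring

theorem length_taylorCons (a m c : ℤ) (s : List ℤ) :
    (taylorCons a m c s).length = s.length + 1 := by
  induction s generalizing c with
  | nil => rfl
  | cons s t ih => simp [taylorCons, ih]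

/-- The coefficients of `D ^ d * l (m (a + u) / D)` as a polynomial in `u`, where `d` is the
degree of `l`. -/
def taylorShift (a m : ℤ) (D : ℕ) : List ℤ → List ℤ
  | [] => []
  | c :: l => taylorCons a m (c * D ^ l.length) (taylorShift a m D l)

theorem length_taylorShift (a m : ℤ) (D : ℕ) (l : List ℤ) :
    (taylorShift a m D l).length = l.length := by
  induction l with
  | nil => rfl
  | cons c l ih => simp [taylorShift, length_taylorCons, ih]

theorem evalList_taylorShift {a m : ℤ} {D : ℕ} (hD : 0 < D) (l : List ℤ) {u x : ℝ}
    (hx : x = m * (a + u) / D) :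
    evalList (taylorShift a m D l) u = D ^ (l.length - 1) * evalList l x := by
  have hD0 : (D : ℝ) ≠ 0 := by exact_mod_cast hD.ne'
  have hx' : m * (a + u) = x * D := by rw [hx]; field_simp
  -- The extra factor D replaces the truncated exponent `length - 1` by `length`, for which the
  -- induction goes through.
  have key : D * evalList (taylorShift a m D l) u = D ^ l.length * evalList l x := by
    induction l with
    | nil => simp [taylorShift, evalList]
    | cons c l ih =>
      simp only [taylorShift, evalList_taylorCons, evalList, List.length_cons, hx']
      push_cast
      linear_combination (x * D) * ih
  cases l with
  | nil => simp [taylorShift, evalList]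
  | cons c l =>
    refine mul_left_cancel₀ hD0 (key.trans ?_)
    simp only [List.length_cons, Nat.add_sub_cancel]
    ring

/-- The sum of the absolute values of the entries. -/
def absSum : List ℤ → ℕ
  | [] => 0
  | c :: l => c.natAbs + absSum l

theorem abs_evalList_le_absSum (l : List ℤ) {u : ℝ} (hu : |u| ≤ 1) :
    |evalList l u| ≤ absSum l := by
  induction l with
  | nil => simp [evalList, absSum]
  | cons c l ih =>
    simp only [evalList, absSum]
    push_cast
    refine (abs_add_le _ _).trans (add_le_add (by rw [Nat.cast_natAbs, Int.cast_abs]) ?_)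
    rw [abs_mul]
    exact (mul_le_of_le_one_left (abs_nonneg _) hu).trans ih

/-- Entrywise sum of coefficient lists. -/
def addList : List ℤ → List ℤ → List ℤ
  | [], t => t
  | s, [] => s
  | a :: s, b :: t => (a + b) :: addList s t

theorem evalList_addList (s t : List ℤ) (u : ℝ) :
    evalList (addList s t) u = evalList s u + evalList t u := by
  induction s generalizing t with
  | nil => simp [addList, evalList]
  | cons a s ih =>
    cases t with
    | nil => simp [addList, evalList]
    | cons b t => simp only [addList, evalList, ih]; push_cast; ring

theorem evalList_map_mul (e : ℤ) (s : List ℤ) (u : ℝ) :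
    evalList (s.map (e * ·)) u = e * evalList s u := by
  induction s with
  | nil => simp [evalList]
  | cons a s ih => simp only [List.map_cons, evalList, ih]; push_cast; ring

/-! ### Weighted sums of logarithms. -/

/-- The sum of `e • g l` over the pairs `(e, l)`. -/
def combine (g : List ℤ → ℤ × List ℤ) : List (ℕ × List ℤ) → ℤ × List ℤ
  | [] => (0, [])
  | f :: fs =>
    (f.1 * (g f.2).1 + (combine g fs).1,
      addList ((g f.2).2.map ((f.1 : ℤ) * ·)) (combine g fs).2)

/-- The logarithm of the absolute value of `n ^ d * P x`, with `P = prodPoly fs` of degree `d`. -/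
noncomputable def logNorm (n : ℕ) (x : ℝ) : List (ℕ × List ℤ) → ℝ
  | [] => 0
  | f :: fs => f.1 * Real.log |(n : ℝ) ^ (f.2.length - 1) * evalList f.2 x| + logNorm n x fs

/-- Both kinds of factor bound are instances: α scales a constant, β a polynomial in u, and γ a
rounding error proportional to the degree. Linearity lets the polynomials be summed before they are
estimated. -/
theorem logNorm_le_combine {n : ℕ} {x u α β γ : ℝ} {g : List ℤ → ℤ × List ℤ}
    {fs : List (ℕ × List ℤ)}
    (h : ∀ f ∈ fs, Real.log |(n : ℝ) ^ (f.2.length - 1) * evalList f.2 x| ≤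
      α * (g f.2).1 + β * evalList (g f.2).2 u + γ * (f.2.length - 1 : ℕ)) :
    logNorm n x fs ≤
      α * (combine g fs).1 + β * evalList (combine g fs).2 u + γ * degSum fs := by
  induction fs with
  | nil => simp [logNorm, combine, degSum, evalList]
  | cons f fs ih =>
    have h1 := mul_le_mul_of_nonneg_left (h f List.mem_cons_self) (Nat.cast_nonneg (α := ℝ) f.1)
    have h2 := ih fun g hg => h g (List.mem_cons_of_mem _ hg)
    simp only [logNorm, combine, degSum, evalList_addList, evalList_map_mul]
    push_cast at h1 ⊢
    linarith

/-- Since `Real.log 0 = 0`, the logarithmic sum is meaningful only where no factor vanishes; at a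
zero of a factor the product is 0, its exponent being positive. -/
theorem abs_aeval_prodPoly_le {n : ℕ} (hn : 0 < n) {fs : List (ℕ × List ℤ)}
    (hpos : ∀ f ∈ fs, 0 < f.1) {x : ℝ}
    (h : (∀ f ∈ fs, evalList f.2 x ≠ 0) → logNorm n x fs ≤ 0) :
    |aeval x (prodPoly fs)| ≤ (1 / (n : ℝ)) ^ degSum fs := by
  have hn0 : (0 : ℝ) < n := by exact_mod_cast hn
  by_cases h0 : ∀ f ∈ fs, evalList f.2 x ≠ 0
  · have key : aeval x (prodPoly fs) ≠ 0 ∧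
        Real.log |(n : ℝ) ^ degSum fs * aeval x (prodPoly fs)| = logNorm n x fs := by
      clear h hpos
      induction fs with
      | nil => simp [prodPoly, logNorm, degSum]
      | cons f fs ih =>
        obtain ⟨h1, h2⟩ := ih fun g hg => h0 g (List.mem_cons_of_mem _ hg)
        have h3 := h0 f List.mem_cons_self
        simp only [prodPoly, map_mul, map_pow, aeval_toPoly]
        refine ⟨mul_ne_zero h1 (pow_ne_zero _ h3), ?_⟩
        rw [logNorm, ← h2, ← Real.log_pow, ← Real.log_mul, degSum, ← abs_pow, ← abs_mul]
        · congr 2; ring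
        · exact pow_ne_zero _ (abs_ne_zero.2 (mul_ne_zero (pow_ne_zero _ hn0.ne') h3))
        · exact abs_ne_zero.2 (mul_ne_zero (pow_ne_zero _ hn0.ne') h1)
    have h1 : |(n : ℝ) ^ degSum fs * aeval x (prodPoly fs)| ≤ 1 := by
      rw [← Real.log_nonpos_iff (abs_nonneg _), key.2]
      exact h h0
    rw [abs_mul, abs_of_pos (by positivity)] at h1
    rw [one_div, inv_pow, ← one_div, le_div_iff₀ (by positivity)]
    linarith
  · push Not at h0
    have : aeval x (prodPoly fs) = 0 := by
      clear h
      obtain ⟨f, hf, hf0⟩ := h0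
      induction fs with
      | nil => simp at hf
      | cons g fs ih =>
        simp only [prodPoly, map_mul, map_pow, aeval_toPoly]
        rcases List.mem_cons.1 hf with rfl | hf'
        · rw [hf0, zero_pow (hpos f List.mem_cons_self).ne', mul_zero]
        · rw [ih (fun g hg => hpos g (List.mem_cons_of_mem _ hg)) hf', zero_mul]
    rw [this, abs_zero]
    positivity

/-! ### Integer upper bounds for logarithms. -/

/-- The number of binary digits of `M`, found by bisection if there are at most `2 ^ k`. -/
def bitLength : ℕ → ℕ → ℕ
  | 0, M => Nat.log2 M + 1
  | k + 1, M =>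
    if Nat.ble (2 ^ 2 ^ k) M then 2 ^ k + bitLength k (M / 2 ^ 2 ^ k) else bitLength k M

theorem lt_two_pow_bitLength (k M : ℕ) : M < 2 ^ bitLength k M := by
  induction k generalizing M with
  | zero => exact Nat.lt_log2_self
  | succ k ih =>
    rw [bitLength]
    split_ifs
    · rw [pow_add, mul_comm]
      exact (Nat.div_lt_iff_lt_mul (by positivity)).1 (ih _)
    · exact ih M

/-- An upper bound for `2 ^ k * log₂ M`, from the leading bits of `M`. -/
def lgUp (k M : ℕ) : ℕ :=
  bitLength (k + 5) ((M / 2 ^ (bitLength 10 M - 24) + 1) ^ 2 ^ k) +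
    2 ^ k * (bitLength 10 M - 24)

/-- Counting the bits of a 2^k-th power measures log₂ in units of 2^(-k). To keep the power small, M
is first replaced by an upper bound B 2^j. -/
theorem two_pow_mul_log_le_lgUp (k : ℕ) {M : ℕ} (hM : 0 < M) :
    2 ^ k * Real.log M ≤ lgUp k M * Real.log 2 := by
  rw [lgUp]
  -- About 24 leading bits are kept; for a shorter M the truncated subtraction gives j = 0.
  set j := bitLength 10 M - 24
  set B := M / 2 ^ j + 1
  have h1 : M ≤ B * 2 ^ j := by
    rw [mul_comm]
    exact (Nat.lt_mul_div_succ _ (by positivity)).le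
  have h2 : M ^ 2 ^ k ≤ 2 ^ (bitLength (k + 5) (B ^ 2 ^ k) + 2 ^ k * j) := by
    rw [pow_add, mul_comm (2 ^ k) j, pow_mul 2 j]
    refine (Nat.pow_le_pow_left h1 _).trans ?_
    rw [mul_pow]
    exact Nat.mul_le_mul_right _ (lt_two_pow_bitLength _ _).le
  have h3 : (M : ℝ) ^ 2 ^ k ≤ 2 ^ (bitLength (k + 5) (B ^ 2 ^ k) + 2 ^ k * j) := by
    exact_mod_cast h2
  have h4 := Real.log_le_log (by positivity) h3
  rw [Real.log_pow, Real.log_pow] at h4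
  exact_mod_cast h4

/-- A number `A` such that `log₂ (v * (n / D) ^ d) ≤ A / 2 ^ 12`. -/
def scaledLg (n D d v : ℕ) : ℤ :=
  (lgUp 12 (v * n ^ d * 2 ^ 60 / D ^ d + 1) : ℤ) - 60 * 2 ^ 12

/-- The factor 2^60 keeps the integer quotient accurate and is removed afterwards as 60 · 2^12 in
units of 2^(-12) bits; the added 1 makes the quotient an upper bound. -/
theorem log_le_scaledLg {n D d v : ℕ} (hD : 0 < D) {y : ℝ} (hy : 0 < y)
    (h : D ^ d * y ≤ v * (n : ℝ) ^ d) :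
    Real.log y ≤ Real.log 2 / 2 ^ 12 * scaledLg n D d v := by
  set M := v * n ^ d * 2 ^ 60 / D ^ d + 1 with hM
  have hD0 : (0 : ℝ) < (D : ℝ) ^ d := by positivity
  have h1 : y * 2 ^ 60 ≤ M := by
    have h2 : v * n ^ d * 2 ^ 60 ≤ D ^ d * M :=
      (Nat.lt_mul_div_succ _ (by positivity)).le
    have h3 : (v : ℝ) * n ^ d * 2 ^ 60 ≤ D ^ d * M := by exact_mod_cast h2
    refine le_of_mul_le_mul_left ?_ hD0
    calc (D : ℝ) ^ d * (y * 2 ^ 60) = D ^ d * y * 2 ^ 60 := by ring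
      _ ≤ (v : ℝ) * n ^ d * 2 ^ 60 := by gcongr
      _ ≤ (D : ℝ) ^ d * M := h3
  have h2 := Real.log_le_log (by positivity) h1
  rw [Real.log_mul hy.ne' (by positivity), Real.log_pow] at h2
  have h3 := two_pow_mul_log_le_lgUp 12 (Nat.succ_pos (v * n ^ d * 2 ^ 60 / D ^ d))
  rw [Nat.succ_eq_add_one, ← hM] at h3
  rw [scaledLg, ← hM]
  push_cast at h2 ⊢
  linarith

/-! ### Bounds on an interval. -/

/-- Data `(A, s)` such that the logarithm of a factor, in the interval with centre `m a / D` and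
radius `m / D`, is up to rounding at most `log 2 * A / 2 ^ 12 + u * s(u) / 2 ^ 60`. -/
def factorBound (n : ℕ) (a m : ℤ) (D : ℕ) (l : List ℤ) : ℤ × List ℤ :=
  match taylorShift a m D l with
  | [] => (0, [])
  | t₀ :: t =>
    if absSum t < t₀.natAbs then
      (scaledLg n D (l.length - 1) t₀.natAbs, t.map fun c => c * 2 ^ 60 / t₀)
    else (scaledLg n D (l.length - 1) (t₀.natAbs + absSum t), [])

/-- Each integer quotient is off by at most one unit of 2^(-60), and |u| ≤ 1 makes the errors add up
to at most one unit per coefficient. -/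
theorem mul_evalList_div_le (t : List ℤ) {t₀ : ℤ} (h0 : t₀ ≠ 0) {u : ℝ} (hu : |u| ≤ 1) :
    |evalList t u / t₀ - 1 / 2 ^ 60 * evalList (t.map fun c => c * 2 ^ 60 / t₀) u| ≤
      1 / 2 ^ 60 * (t.length : ℝ) := by
  have h0' : (t₀ : ℝ) ≠ 0 := by exact_mod_cast h0
  induction t with
  | nil => simp [evalList]
  | cons c t ih =>
    have h1 : |(c : ℝ) / t₀ - 1 / 2 ^ 60 * (c * 2 ^ 60 / t₀ : ℤ)| ≤ 1 / 2 ^ 60 := by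
      have h2 : (t₀ : ℝ) * (c * 2 ^ 60 / t₀ : ℤ) + (c * 2 ^ 60 % t₀ : ℤ) = c * 2 ^ 60 := by
        have := congrArg (Int.cast (R := ℝ)) (Int.mul_ediv_add_emod (c * 2 ^ 60) t₀)
        push_cast at this ⊢
        linarith
      have h3 : |((c * 2 ^ 60 % t₀ : ℤ) : ℝ)| ≤ |(t₀ : ℝ)| := by
        have h4 := Int.emod_nonneg (c * 2 ^ 60) h0
        have h5 := (Int.emod_lt_abs (c * 2 ^ 60) h0).le
        rw [← abs_of_nonneg h4] at h5
        exact_mod_cast h5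
      have h4 : (c : ℝ) / t₀ - 1 / 2 ^ 60 * (c * 2 ^ 60 / t₀ : ℤ) =
          1 / 2 ^ 60 * ((c * 2 ^ 60 % t₀ : ℤ) / t₀) := by
        field_simp
        linear_combination -h2
      rw [h4, abs_mul, abs_of_pos (by positivity : (0 : ℝ) < 1 / 2 ^ 60), abs_div]
      exact mul_le_of_le_one_right (by positivity)
        ((div_le_one (abs_pos.2 h0')).2 h3)
    simp only [evalList, List.map_cons, List.length_cons]
    have h2 := (mul_le_of_le_one_left (abs_nonneg _) hu).trans ih
    rw [← abs_mul] at h2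
    calc _ = |((c : ℝ) / t₀ - 1 / 2 ^ 60 * (c * 2 ^ 60 / t₀ : ℤ)) +
          u * (evalList t u / t₀ -
            1 / 2 ^ 60 * evalList (t.map fun c => c * 2 ^ 60 / t₀) u)| := by
          congr 1; ring
      _ ≤ _ := (abs_add_le _ _).trans (add_le_add h1 h2)
      _ = _ := by push_cast; ring

/-- If the constant Taylor coefficient t₀ dominates the others, the factor is t₀ (1 + w) / D^d with
|w| < 1, and log (1 + w) ≤ w keeps the dependence on u as a polynomial that can cancel against other
factors. Otherwise the factor may have a zero in the interval, and only the maximum of its absolute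
value is used. -/
theorem log_le_factorBound {n : ℕ} (hn : 0 < n) {a m : ℤ} {D : ℕ} (hD : 0 < D) (l : List ℤ)
    {u x : ℝ} (hu : |u| ≤ 1) (hx : x = m * (a + u) / D) (h0 : evalList l x ≠ 0) :
    Real.log |(n : ℝ) ^ (l.length - 1) * evalList l x| ≤
      Real.log 2 / 2 ^ 12 * (factorBound n a m D l).1 +
        u / 2 ^ 60 * evalList (factorBound n a m D l).2 u + 1 / 2 ^ 60 * (l.length - 1 : ℕ) := by
  have heval := evalList_taylorShift hD l hx
  have hlen := length_taylorShift a m D l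
  set d := l.length - 1 with hd
  have hn0 : (0 : ℝ) < n := by exact_mod_cast hn
  have hDd : (0 : ℝ) < (D : ℝ) ^ d := by positivity
  have hy : 0 < |(n : ℝ) ^ d * evalList l x| :=
    abs_pos.2 (mul_ne_zero (by positivity) h0)
  have hlog : ∀ v : ℕ, |evalList (taylorShift a m D l) u| ≤ v →
      Real.log |(n : ℝ) ^ d * evalList l x| ≤ Real.log 2 / 2 ^ 12 * scaledLg n D d v := by
    intro v hv
    refine log_le_scaledLg hD hy ?_
    rw [heval, abs_mul, abs_of_pos hDd] at hv
    rw [abs_mul, abs_of_pos (by positivity : (0 : ℝ) < (n : ℝ) ^ d)]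
    calc _ = (D : ℝ) ^ d * |evalList l x| * n ^ d := by ring
      _ ≤ _ := by gcongr
  rw [factorBound]
  cases hT : taylorShift a m D l with
  | nil =>
    rw [hT] at hlen
    rw [List.length_eq_zero_iff.1 hlen.symm] at h0
    simp [evalList] at h0
  | cons t₀ t =>
    rw [hT] at heval hlog hlen
    have hdt : d = t.length := by rw [hd, ← hlen]; simp
    have ht := abs_evalList_le_absSum t hu
    have hut : |u * evalList t u| ≤ absSum t := by
      rw [abs_mul]
      exact (mul_le_of_le_one_left (abs_nonneg _) hu).trans ht
    have ht₀ : ((t₀.natAbs : ℕ) : ℝ) = |(t₀ : ℝ)| := by rw [Nat.cast_natAbs, Int.cast_abs]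
    simp only
    split_ifs with hlt
    · have h1 : (absSum t : ℝ) < |(t₀ : ℝ)| := by rw [← ht₀]; exact_mod_cast hlt
      have ht0 : (t₀ : ℝ) ≠ 0 := abs_pos.1 ((Nat.cast_nonneg _).trans_lt h1)
      have hw : |u * evalList t u / t₀| < 1 := by
        rw [abs_div, div_lt_one (abs_pos.2 ht0)]
        exact hut.trans_lt h1
      set w := u * evalList t u / t₀ with hw'
      have hw1 : 0 < 1 + w := by linarith [(abs_lt.1 hw).1]
      have hfac : |(n : ℝ) ^ d * evalList l x| =
          (|(t₀ : ℝ)| * n ^ d / D ^ d) * (1 + w) := by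
        have h2 : evalList l x = t₀ * (1 + w) / D ^ d := by
          rw [eq_div_iff hDd.ne', mul_comm, ← heval, evalList, hw']
          field_simp
        rw [h2, abs_mul, abs_div, abs_mul, abs_of_pos hw1, abs_of_pos hDd,
          abs_of_pos (by positivity : (0 : ℝ) < (n : ℝ) ^ d)]
        ring
      have hA : 0 < |(t₀ : ℝ)| * n ^ d / D ^ d := by
        have := abs_pos.2 ht0
        positivity
      rw [hfac, Real.log_mul hA.ne' hw1.ne']
      have h2 : Real.log (|(t₀ : ℝ)| * n ^ d / D ^ d) ≤
          Real.log 2 / 2 ^ 12 * scaledLg n D d t₀.natAbs := by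
        refine log_le_scaledLg hD hA ?_
        rw [ht₀]
        exact (mul_div_cancel₀ _ hDd.ne').le
      have h3 : Real.log (1 + w) ≤ w := by linarith [Real.log_le_sub_one_of_pos hw1]
      have h4 := mul_evalList_div_le t (by exact_mod_cast ht0) hu
      have h5 := (mul_le_of_le_one_left (abs_nonneg _) hu).trans h4
      rw [← abs_mul] at h5
      have h6 := (abs_le.1 h5).2
      rw [← hd]
      rw [hdt] at h2 ⊢
      have h7 : w = u * (evalList t u / t₀) := by rw [hw']; ring
      rw [h7] at h3 ⊢
      dsimp only
      linarith
    · have h1 := hlog (t₀.natAbs + absSum t) (by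
        rw [evalList]; push_cast; rw [ht₀]
        exact (abs_add_le _ _).trans (add_le_add le_rfl hut))
      simp only [evalList, mul_zero, add_zero]
      have : (0 : ℝ) ≤ 1 / 2 ^ 60 * (d : ℝ) := by positivity
      linarith

/-- The certificate that `logNorm n x fs ≤ 0` in the interval with centre `m a / D` and radius
`m / D`. -/
def intervalCheck (n : ℕ) (m : ℤ) (fs : List (ℕ × List ℤ)) (a : ℤ) (D : ℕ) : Bool :=
  decide (3 * 2 ^ 12 * ((absSum (combine (factorBound n a m D) fs).2 : ℤ) + degSum fs) +
    2 * 2 ^ 60 * (combine (factorBound n a m D) fs).1 ≤ 0)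

theorem logNorm_nonpos_of_intervalCheck {n : ℕ} (hn : 0 < n) {m a : ℤ} {D : ℕ} (hD : 0 < D)
    {fs : List (ℕ × List ℤ)} (hc : intervalCheck n m fs a D = true) {u x : ℝ} (hu : |u| ≤ 1)
    (hx : x = m * (a + u) / D) (h0 : ∀ f ∈ fs, evalList f.2 x ≠ 0) : logNorm n x fs ≤ 0 := by
  have h1 := logNorm_le_combine (n := n) fun f hf =>
    log_le_factorBound hn hD f.2 hu hx (h0 f hf)
  have hc' := of_decide_eq_true hc
  set A := (combine (factorBound n a m D) fs).1
  set S := (combine (factorBound n a m D) fs).2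
  have h2 : u / 2 ^ 60 * evalList S u ≤ 1 / 2 ^ 60 * absSum S := by
    have h3 : u * evalList S u ≤ absSum S := by
      refine (le_abs_self _).trans ?_
      rw [abs_mul]
      exact (mul_le_of_le_one_left (abs_nonneg _) hu).trans (abs_evalList_le_absSum S hu)
    linarith
  have h3 : (3 * 2 ^ 12 * ((absSum S : ℝ) + degSum fs) + 2 * 2 ^ 60 * A) ≤ 0 := by
    exact_mod_cast hc'
  have h4 : (A : ℝ) ≤ 0 := by
    have : (0 : ℝ) ≤ (absSum S : ℝ) + degSum fs := by positivity
    linarith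
  have h5 : Real.log 2 * A ≤ 2 / 3 * A :=
    -- As A ≤ 0, only the lower bound log 2 ≥ 2/3 is needed; it explains the weights 3 and 2 in
    -- `intervalCheck`.
    mul_le_mul_of_nonpos_right (by linarith [Real.log_two_gt_d9]) h4
  linarith

/-! ### Second-order analysis near 1/n. -/

theorem log_one_add_le {w : ℝ} (hw : |w| ≤ 1 / 2) :
    Real.log (1 + w) ≤ w - w ^ 2 / 2 + 2 * |w| ^ 3 := by
  have h1 : |-w| < 1 := by rw [abs_neg]; linarith
  have h2 := (abs_le.1 (Real.abs_log_sub_add_sum_range_le h1 2)).2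
  simp only [Finset.sum_range_succ, Finset.sum_range_zero, abs_neg, sub_neg_eq_add] at h2
  norm_num at h2
  have h3 : |w| ^ 3 / (1 - |w|) ≤ 2 * |w| ^ 3 := by
    rw [div_le_iff₀ (by linarith)]
    nlinarith [pow_nonneg (abs_nonneg w) 3]
  linarith

/-- An upper bound for the absolute value of a polynomial on `|u| ≤ 1 / R`. -/
def tailBound (R : ℕ) : List ℤ → ℕ
  | [] => 0
  | c :: l => c.natAbs + (tailBound R l / R + 1)

/-- Horner's scheme with |u| ≤ 1/R; the quotient by R is rounded up at each stage to stay in ℕ. -/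
theorem abs_evalList_le_tailBound {R : ℕ} (hR : 0 < R) (l : List ℤ) {u : ℝ}
    (hu : |u| ≤ 1 / R) : |evalList l u| ≤ tailBound R l := by
  have hR0 : (0 : ℝ) < R := by exact_mod_cast hR
  induction l with
  | nil => simp [evalList, tailBound]
  | cons c l ih =>
    simp only [evalList, tailBound]
    push_cast
    refine (abs_add_le _ _).trans (add_le_add (by rw [Nat.cast_natAbs, Int.cast_abs]) ?_)
    rw [abs_mul]
    refine (mul_le_mul hu ih (abs_nonneg _) (by positivity)).trans ?_
    rw [one_div_mul_eq_div, div_le_iff₀ hR0, mul_comm]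
    exact_mod_cast (Nat.lt_mul_div_succ (tailBound R l) hR).le

theorem evalList_eq_headD_add (l : List ℤ) (u : ℝ) :
    evalList l u = l.headD 0 + u * evalList l.tail u := by
  cases l <;> simp [evalList]

/-- The normalised expansion of a factor at `1 / n`, in the variable `u = n x - 1`, without its
constant term. -/
def localCoeffs (n : ℕ) (l : List ℤ) : List ℤ :=
  (taylorShift 1 1 n l).tail.map ((taylorShift 1 1 n l).headD 0 * ·)

/-- Data `(B, s)` such that the logarithm of a factor is at most `u * s(u) + u² * B / (2 R⁴)` for
`u = n x - 1` and `|u| ≤ 1 / R`. -/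
def localBound (n R : ℕ) (l : List ℤ) : ℤ × List ℤ :=
  (- R ^ 4 * |(localCoeffs n l).headD 0| ^ 2 +
      2 * R ^ 3 * |(localCoeffs n l).headD 0| * tailBound R (localCoeffs n l).tail +
      4 * (R * |(localCoeffs n l).headD 0| + tailBound R (localCoeffs n l).tail) ^ 3,
    localCoeffs n l)

/-- The condition under which `localBound` is valid for a factor. -/
def localValid (n R : ℕ) (l : List ℤ) : Bool :=
  decide (|(taylorShift 1 1 n l).headD 0| = 1) &&
    decide (2 * (R * |(localCoeffs n l).headD 0| + tailBound R (localCoeffs n l).tail) ≤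
      (R : ℤ) ^ 2)

/-- The value at 1/n being ±1 after scaling, the factor is ±(1 + w) with w = u (k + u h(u)) and |h|
≤ H. In w - w²/2 + 2|w|³ the linear term is kept exactly, while w² ≥ u² (k² - 2|k|H/R) and |w|³ ≤ u²
G³/R⁴ with G = R|k| + H. The second condition of `localValid` says G/R² ≤ 1/2, hence |w| ≤ 1/2. -/
theorem log_le_localBound {n R : ℕ} (hn : 0 < n) (hR : 0 < R) {l : List ℤ}
    (hl : localValid n R l = true) {u x : ℝ} (hu : |u| ≤ 1 / R) (hx : x = (1 + u) / n) :
    Real.log |(n : ℝ) ^ (l.length - 1) * evalList l x| ≤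
      u ^ 2 / (2 * R ^ 4) * (localBound n R l).1 + u * evalList (localBound n R l).2 u +
        0 * (l.length - 1 : ℕ) := by
  obtain ⟨h0, h1⟩ := (Bool.and_eq_true _ _).mp hl
  replace h0 := of_decide_eq_true h0
  replace h1 := of_decide_eq_true h1
  have hR0 : (0 : ℝ) < R := by exact_mod_cast hR
  rw [← evalList_taylorShift (a := 1) (m := 1) (u := u) hn l (by rw [hx]; simp)]
  set t := taylorShift 1 1 n l with ht
  simp only [localBound]
  set c := localCoeffs n l with hc
  have hct : evalList c u = (t.headD 0 : ℤ) * evalList t.tail u := by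
    rw [hc, localCoeffs, ← ht, evalList_map_mul]
  have ht2 : ((t.headD 0 : ℤ) : ℝ) * (t.headD 0 : ℤ) = 1 := by
    have : |((t.headD 0 : ℤ) : ℝ)| = 1 := by exact_mod_cast h0
    rw [← abs_mul_abs_self, this, one_mul]
  have hw : |evalList t u| = |1 + u * evalList c u| := by
    have h2 : 1 + u * evalList c u = (t.headD 0 : ℤ) * evalList t u := by
      rw [hct, evalList_eq_headD_add t u]; linear_combination -ht2
    rw [h2, abs_mul]
    have : |((t.headD 0 : ℤ) : ℝ)| = 1 := by exact_mod_cast h0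
    rw [this, one_mul]
  set k := c.headD 0 with hk
  set H := tailBound R c.tail with hH
  have hh := abs_evalList_le_tailBound hR c.tail hu
  set h := evalList c.tail u
  have hce : evalList c u = k + u * h := evalList_eq_headD_add c u
  have huh : |u * h| ≤ H / R := by
    rw [abs_mul, div_eq_inv_mul, ← one_div]
    exact mul_le_mul hu hh (abs_nonneg _) (by positivity)
  have hg : |evalList c u| ≤ |(k : ℝ)| + H / R := by
    rw [hce]; exact (abs_add_le _ _).trans (add_le_add le_rfl huh)
  have hgR : |(k : ℝ)| + H / R = (R * |(k : ℝ)| + H) / R := by field_simp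
  have h1' : 2 * (R * |(k : ℝ)| + H) ≤ (R : ℝ) ^ 2 := by exact_mod_cast h1
  set G := R * |(k : ℝ)| + H with hG
  have hG0 : 0 ≤ G := by positivity
  rw [hgR] at hg
  have hwle : |u * evalList c u| ≤ |u| * (G / R) := by
    rw [abs_mul]; exact mul_le_mul_of_nonneg_left hg (abs_nonneg _)
  have hwhalf : |u * evalList c u| ≤ 1 / 2 := by
    refine hwle.trans ((mul_le_mul_of_nonneg_right hu (by positivity)).trans ?_)
    rw [div_mul_div_comm, one_mul, div_le_div_iff₀ (by positivity) two_pos]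
    linarith
  have hpos : 0 < 1 + u * evalList c u := by linarith [(abs_le.1 hwhalf).1]
  rw [hw, abs_of_pos hpos]
  refine (log_one_add_le hwhalf).trans ?_
  have hcube : |u * evalList c u| ^ 3 ≤ u ^ 2 * (G ^ 3 / R ^ 4) := by
    calc _ ≤ (|u| * (G / R)) ^ 3 := pow_le_pow_left₀ (abs_nonneg _) hwle 3
      _ = |u| ^ 2 * (|u| * (G / R) ^ 3) := by ring
      _ ≤ |u| ^ 2 * (1 / R * (G / R) ^ 3) := by gcongr
      _ = _ := by rw [sq_abs]; field_simp
  have hsq : u ^ 2 * (k ^ 2 - 2 * |(k : ℝ)| * (H / R)) ≤ (u * evalList c u) ^ 2 := by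
    rw [mul_pow, hce]
    refine mul_le_mul_of_nonneg_left ?_ (sq_nonneg u)
    have h2 : -((k : ℝ) * (u * h)) ≤ |(k : ℝ)| * (H / R) := by
      refine (neg_le_abs _).trans ?_
      rw [abs_mul]
      exact mul_le_mul_of_nonneg_left huh (abs_nonneg _)
    nlinarith [sq_nonneg (u * h)]
  have hrhs : u ^ 2 / (2 * R ^ 4) *
      ((-R ^ 4 * |k| ^ 2 + 2 * R ^ 3 * |k| * H + 4 * (R * |k| + H) ^ 3 : ℤ) : ℝ) =
      - (u ^ 2 * (k ^ 2 - 2 * |(k : ℝ)| * (H / R))) / 2 + 2 * (u ^ 2 * (G ^ 3 / R ^ 4)) := by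
    push_cast
    rw [← hG, sq_abs]
    field_simp
    ring
  rw [hrhs]
  linarith

/-- The certificate that `logNorm n x fs ≤ 0` for `|n x - 1| ≤ 1 / R`. -/
def localCheck (n R : ℕ) (fs : List (ℕ × List ℤ)) : Bool :=
  fs.all (fun f => localValid n R f.2) &&
    (decide ((combine (localBound n R) fs).2.headD 0 = 0) &&
    decide (2 * R ^ 4 * (combine (localBound n R) fs).2.tail.headD 0 +
      2 * R ^ 3 * (tailBound R (combine (localBound n R) fs).2.tail.tail : ℤ) +
      (combine (localBound n R) fs).1 ≤ 0))

/-- The vanishing head of the combined list is the vanishing of the bound's first-order term at 1/n.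
What remains is u² times a quantity whose upper bound is checked to be nonpositive. -/
theorem logNorm_nonpos_of_localCheck {n R : ℕ} (hn : 0 < n) (hR : 0 < R)
    {fs : List (ℕ × List ℤ)} (hc : localCheck n R fs = true) {x : ℝ}
    (hx : |n * x - 1| ≤ 1 / R) : logNorm n x fs ≤ 0 := by
  obtain ⟨h1, h2⟩ := (Bool.and_eq_true _ _).mp hc
  obtain ⟨h4, h3⟩ := (Bool.and_eq_true _ _).mp h2
  clear h2
  have h1 := List.all_eq_true.1 h1
  have h2 := of_decide_eq_true h4
  clear h4
  replace h3 := of_decide_eq_true h3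
  have hn0 : (0 : ℝ) < n := by exact_mod_cast hn
  have hR0 : (0 : ℝ) < R := by exact_mod_cast hR
  have h4 := logNorm_le_combine (n := n) fun f hf =>
    log_le_localBound hn hR (h1 f hf) hx (x := x) (by field_simp; ring)
  refine h4.trans ?_
  set u := n * x - 1
  set B := (combine (localBound n R) fs).1
  set S := (combine (localBound n R) fs).2
  rw [evalList_eq_headD_add S, evalList_eq_headD_add S.tail, h2]
  set s := S.tail.headD 0
  have h5 := abs_evalList_le_tailBound hR S.tail.tail hx
  set T := tailBound R S.tail.tail
  have h6 : u * evalList S.tail.tail u ≤ T / R := by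
    refine (le_abs_self _).trans ?_
    rw [abs_mul, div_eq_inv_mul, ← one_div]
    exact mul_le_mul hx h5 (abs_nonneg _) (by positivity)
  have h7 : 2 * R ^ 4 * (s : ℝ) + 2 * R ^ 3 * T + B ≤ 0 := by exact_mod_cast h3
  have h8 : (s : ℝ) + T / R + B / (2 * R ^ 4) ≤ 0 := by
    have : (s : ℝ) + T / R + B / (2 * R ^ 4) =
        (2 * R ^ 4 * (s : ℝ) + 2 * R ^ 3 * T + B) / (2 * R ^ 4) := by field_simp
    rw [this]
    exact div_nonpos_of_nonpos_of_nonneg h7 (by positivity)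
  calc _ = u ^ 2 * (s + u * evalList S.tail.tail u + B / (2 * R ^ 4)) := by push_cast; ring
    _ ≤ 0 := mul_nonpos_of_nonneg_of_nonpos (sq_nonneg u) (by linarith)

/-! ### Covering the interval by bisection. -/

/-- The certificate that `logNorm n x fs ≤ 0` in the interval with centre `m a / D` and radius
`m / D`, up to `|n x - 1| ≤ 1 / R`, found by bisection to a limited depth. -/
def cover (n R m : ℕ) (fs : List (ℕ × List ℤ)) : ℕ → ℤ → ℕ → Bool
  | 0, _, _ => false
  | k + 1, a, D =>
    decide (R * (|n * m * a - D| + n * m) ≤ (D : ℤ)) || (intervalCheck n m fs a D ||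
      (cover n R m fs k (2 * a - 1) (2 * D) && cover n R m fs k (2 * a + 1) (2 * D)))

theorem logNorm_nonpos_of_cover {n R m : ℕ} (hn : 0 < n) (hR : 0 < R)
    {fs : List (ℕ × List ℤ)} (hloc : localCheck n R fs = true) {k : ℕ} {a : ℤ} {D : ℕ}
    (hD : 0 < D) (hc : cover n R m fs k a D = true) {u x : ℝ} (hu : |u| ≤ 1)
    (hx : x = m * (a + u) / D) (h0 : ∀ f ∈ fs, evalList f.2 x ≠ 0) : logNorm n x fs ≤ 0 := by
  have hR0 : (0 : ℝ) < R := by exact_mod_cast hR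
  have hD0 : (0 : ℝ) < D := by exact_mod_cast hD
  induction k generalizing a D u with
  | zero => simp [cover] at hc
  | succ k ih =>
    rw [cover, Bool.or_eq_true, Bool.or_eq_true, Bool.and_eq_true] at hc
    rcases hc with hc | hc | ⟨hc1, hc2⟩
    · refine logNorm_nonpos_of_localCheck hn hR hloc ?_
      have hc' : (R : ℝ) * (|(n * m * a - D : ℝ)| + n * m) ≤ D := by
        exact_mod_cast of_decide_eq_true hc
      have h1 : n * x - 1 = ((n * m * a - D) + n * m * u) / D := by
        rw [hx]; field_simp; ring
      rw [h1, abs_div, abs_of_pos hD0, div_le_div_iff₀ hD0 hR0, one_mul, mul_comm]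
      refine le_trans (mul_le_mul_of_nonneg_left ?_ hR0.le) hc'
      refine (abs_add_le _ _).trans (add_le_add le_rfl ?_)
      rw [abs_mul, abs_of_nonneg (by positivity : (0 : ℝ) ≤ n * m)]
      exact mul_le_of_le_one_right (by positivity) hu
    · exact logNorm_nonpos_of_intervalCheck hn hD hc hu (by exact_mod_cast hx) h0
    · rw [abs_le] at hu
      -- Doubling D halves the radius; the halves have centres 2a - 1 and 2a + 1 over 2D, with local
      -- variables 2u + 1 and 2u - 1.
      rcases le_total u 0 with hu0 | hu0
      · refine ih (u := 2 * u + 1) (by omega) hc1 (abs_le.2 ⟨by linarith, by linarith⟩) ?_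
          (by positivity)
        rw [hx]; push_cast; field_simp; ring
      · refine ih (u := 2 * u - 1) (by omega) hc2 (abs_le.2 ⟨by linarith, by linarith⟩) ?_
          (by positivity)
        rw [hx]; push_cast; field_simp; ring

/-- The bisection starts at a = 1, where centre and radius are both m/D, so that it begins with
exactly [0, 2m/D]. -/
theorem abs_aeval_prodPoly_le_of_cover {n R m k D : ℕ} (hn : 0 < n) (hR : 0 < R) (hD : 0 < D)
    (hm : 0 < m) {fs : List (ℕ × List ℤ)} (hpos : ∀ f ∈ fs, 0 < f.1)
    (hloc : localCheck n R fs = true) (hc : cover n R m fs k 1 D = true) {x : ℝ}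
    (hx : x ∈ Set.Icc 0 (2 * m / D : ℝ)) :
    |aeval x (prodPoly fs)| ≤ (1 / (n : ℝ)) ^ degSum fs := by
  have hD0 : (0 : ℝ) < D := by exact_mod_cast hD
  have hm0 : (0 : ℝ) < m := by exact_mod_cast hm
  refine abs_aeval_prodPoly_le hn hpos
    (logNorm_nonpos_of_cover hn hR hloc hD hc (u := x * D / m - 1) ?_ ?_)
  · have h1 : x * D ≤ 2 * m := (le_div_iff₀ hD0).1 hx.2
    have h2 : x * D / m ≤ 2 := (div_le_iff₀ hm0).2 h1
    have h3 : 0 ≤ x * D / m := div_nonneg (mul_nonneg hx.1 hD0.le) hm0.le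
    exact abs_le.2 ⟨by linarith, by linarith⟩
  · push_cast; field_simp; ring

theorem attains_and_le_bMax {n R m k D : ℕ} {b : ℝ} (hn : 2 < n) (hR : 0 < R) (hD : 0 < D)
    (hm : 0 < m) (hb : b = 2 * m / D) (hnb : 1 / (n : ℝ) < b) (hb1 : b ≤ 1)
    {fs : List (ℕ × List ℤ)}
    (hfs : ∀ f ∈ fs, 0 < f.1 ∧ f.2.getLast? = some 1) (hdeg : 0 < degSum fs)
    (hloc : localCheck n R fs = true) (hc : cover n R m fs k 1 D = true)
    {p : ℤ[X]} (hp : p = prodPoly fs) :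
    AttainsMaximalObstruction p (Set.Ico 0 b) (1 / (n : ℝ)) ∧ b ≤ bMax n := by
  obtain ⟨hmon, hnat⟩ := prodPoly_monic_natDegree fun f hf => (hfs f hf).2
  rw [← hp] at hmon hnat
  have hB : ∀ x ∈ Set.Icc 0 b, |aeval x p| ≤ (1 / (n : ℝ)) ^ p.natDegree := by
    intro x hx
    rw [hnat, hp]
    rw [hb] at hx
    exact abs_aeval_prodPoly_le_of_cover (by omega) hR hD hm (fun f hf => (hfs f hf).1) hloc hc hx
  rw [← hnat] at hdeg
  exact ⟨attainsMaximalObstruction_of_forall_le (by omega) hmon hdeg hnb hB,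
    le_bMax_of_forall_le hn hmon hdeg hnb hb1 hB⟩

/-! ### Data and certificates for n = 3, …, 8. -/

/-- The coefficients of the factors of `P3`, in reverse order. -/
def coeffs3 : List (List ℤ) :=
  [[-1, 6, -11, 7, -3, 1],
    [-1, 21, -179, 791, -1913, 2406, -1233, 1],
    [-2, 50, -516, 2864, -9271, 17561, -18072, 7812, 1],
    [-1, 26, -278, 1594, -5317, 10355, -10935, 4842, 1],
    [-7, 153, -1405, 7041, -20832, 36442, -34944, 14184, 1],
    [1, -52, 1211, -16766, 154318, -999261, 4692047, -16202606, 41208853, -76341256, 100247244,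
     -88456310, 47054086, -11406261, 1],
    [0, 1]]

/-- The factors of `P3` with their exponents, in reverse order. -/
def factors3 : List (ℕ × List ℤ) :=
  [1052898, 1210840, 595980, 2571030, 877415, 2450525, 45944640].zip coeffs3

/-- The coefficients of the factors of `P4`, in reverse order. -/
def coeffs4 : List (List ℤ) :=
  [[2, -50, 514, -2784, 8388, -13342, 8760, 1],
    [2, -31, 179, -456, 432, 1],
    [0, 1]]

/-- The factors of `P4` with their exponents, in reverse order. -/
def factors4 : List (ℕ × List ℤ) :=
  [35, 47, 640].zip coeffs4

/-- The coefficients of the factors of `P5`, in reverse order. -/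
def coeffs5 : List (List ℤ) :=
  [[-1, 28, -310, 1698, -4605, 4950, 1],
    [-1, 52, -1192, 15818, -133974, 751349, -2790988, 6623719, -9115714, 5544095, 1],
    [0, 1]]

/-- The factors of `P5` with their exponents, in reverse order. -/
def factors5 : List (ℕ × List ℤ) :=
  [21825, 78796, 1050990].zip coeffs5

/-- The coefficients of the factors of `P6`, in reverse order. -/
def coeffs6 : List (List ℤ) :=
  [[-2, 78, -1261, 10819, -51966, 132517, -140190, 1],
    [1, -24, 215, -852, 1260, 1],
    [0, 1]]

/-- The factors of `P6` with their exponents, in reverse order. -/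
def factors6 : List (ℕ × List ℤ) :=
  [200917, 118824, 5232473].zip coeffs6

/-- The coefficients of the factors of `P7`, in reverse order. -/
def coeffs7 : List (List ℤ) :=
  [[1, -31, 358, -1826, 3472, 1],
    [0, 1]]

/-- The factors of `P7` with their exponents, in reverse order. -/
def factors7 : List (ℕ × List ℤ) :=
  [1, 44].zip coeffs7

/-- The coefficients of the factors of `P8`, in reverse order. -/
def coeffs8 : List (List ℤ) :=
  [[1, -25, 208, -576, 1],
    [1, -8, 1],
    [0, 1]]

/-- The factors of `P8` with their exponents, in reverse order. -/
def factors8 : List (ℕ × List ℤ) :=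
  [741, 246, 12288].zip coeffs8

/-- The radius 1/R is a compromise: small enough for the second-order term to beat the remainders,
large enough for interval bounds to succeed outside it within the allowed depth. -/
theorem localCheck_factors3 : localCheck 3 256 factors3 = true := by
  decide +kernel

theorem cover_factors3 : cover 3 256 93 factors3 16 1 400 = true := by
  decide +kernel

theorem localCheck_factors4 : localCheck 4 256 factors4 = true := by
  decide +kernel

theorem cover_factors4 : cover 4 256 303 factors4 16 1 2000 = true := by
  decide +kernel

theorem localCheck_factors5 : localCheck 5 64 factors5 = true := by
  decide +kernel

theorem cover_factors5 : cover 5 64 23 factors5 16 1 200 = true := by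
  decide +kernel

theorem localCheck_factors6 : localCheck 6 128 factors6 = true := by
  decide +kernel

theorem cover_factors6 : cover 6 128 23 factors6 16 1 250 = true := by
  decide +kernel

theorem localCheck_factors7 : localCheck 7 512 factors7 = true := by
  decide +kernel

theorem cover_factors7 : cover 7 512 37 factors7 16 1 500 = true := by
  decide +kernel

theorem localCheck_factors8 : localCheck 8 256 factors8 = true := by
  decide +kernel

theorem cover_factors8 : cover 8 256 13 factors8 16 1 200 = true := by
  decide +kernel

/-! ### Identification of the polynomials with their factor lists. -/

/-- Products associate to the left, so the last factor is peeled off first and becomes the head of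
the list; hence the reversed order of the data. -/
theorem mul_pow_eq_prodPoly_cons {p q : ℤ[X]} {e : ℕ} {l : List ℤ}
    {fs : List (ℕ × List ℤ)}
    (hq : q = prodPoly fs) (hp : p = toPoly l) : q * p ^ e = prodPoly ((e, l) :: fs) := by
  rw [prodPoly, hp, hq]

theorem pow_eq_prodPoly_singleton {p : ℤ[X]} {e : ℕ} {l : List ℤ} (hp : p = toPoly l) :
    p ^ e = prodPoly [(e, l)] := by
  rw [prodPoly, prodPoly, hp, one_mul]

/-- The polynomial `P3` with arbitrary exponents, so that large powers are not unfolded. -/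
noncomputable def P3OfExponents (e₀ e₁ e₂ e₃ e₄ e₅ e₆ : ℕ) : ℤ[X] :=
  X ^ e₀ *
  (X ^ 14 - 11406261 * X ^ 13 + 47054086 * X ^ 12 - 88456310 * X ^ 11 + 100247244 * X ^ 10
    - 76341256 * X ^ 9 + 41208853 * X ^ 8 - 16202606 * X ^ 7 + 4692047 * X ^ 6 - 999261 * X ^ 5
    + 154318 * X ^ 4 - 16766 * X ^ 3 + 1211 * X ^ 2 - 52 * X + 1) ^ e₁ *
  (X ^ 8 + 14184 * X ^ 7 - 34944 * X ^ 6 + 36442 * X ^ 5 - 20832 * X ^ 4 + 7041 * X ^ 3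
    - 1405 * X ^ 2 + 153 * X - 7) ^ e₂ *
  (X ^ 8 + 4842 * X ^ 7 - 10935 * X ^ 6 + 10355 * X ^ 5 - 5317 * X ^ 4 + 1594 * X ^ 3
    - 278 * X ^ 2 + 26 * X - 1) ^ e₃ *
  (X ^ 8 + 7812 * X ^ 7 - 18072 * X ^ 6 + 17561 * X ^ 5 - 9271 * X ^ 4 + 2864 * X ^ 3
    - 516 * X ^ 2 + 50 * X - 2) ^ e₄ *
  (X ^ 7 - 1233 * X ^ 6 + 2406 * X ^ 5 - 1913 * X ^ 4 + 791 * X ^ 3 - 179 * X ^ 2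
    + 21 * X - 1) ^ e₅ *
  (X ^ 5 - 3 * X ^ 4 + 7 * X ^ 3 - 11 * X ^ 2 + 6 * X - 1) ^ e₆

theorem P3OfExponents_eq_prodPoly (e₀ e₁ e₂ e₃ e₄ e₅ e₆ : ℕ) :
    P3OfExponents e₀ e₁ e₂ e₃ e₄ e₅ e₆ =
      prodPoly (List.zip [e₆, e₅, e₄, e₃, e₂, e₁, e₀] coeffs3) := by
  rw [P3OfExponents, coeffs3]
  refine mul_pow_eq_prodPoly_cons ?_ (by simp [toPoly]; ring)
  refine mul_pow_eq_prodPoly_cons ?_ (by simp [toPoly]; ring)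
  refine mul_pow_eq_prodPoly_cons ?_ (by simp [toPoly]; ring)
  refine mul_pow_eq_prodPoly_cons ?_ (by simp [toPoly]; ring)
  refine mul_pow_eq_prodPoly_cons ?_ (by simp [toPoly]; ring)
  refine mul_pow_eq_prodPoly_cons ?_ (by simp [toPoly]; ring)
  exact pow_eq_prodPoly_singleton (by simp [toPoly])

theorem P3_eq_prodPoly : P3 = prodPoly factors3 := by
  have h : P3 = P3OfExponents 45944640 2450525 877415 2571030 595980 1210840 1052898 := by
    exact Eq.refl P3
  rw [h, P3OfExponents_eq_prodPoly, factors3]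

/-- The polynomial `P4` with arbitrary exponents, so that large powers are not unfolded. -/
noncomputable def P4OfExponents (e₀ e₁ e₂ : ℕ) : ℤ[X] :=
  X ^ e₀ *
  (X ^ 5 + 432 * X ^ 4 - 456 * X ^ 3 + 179 * X ^ 2 - 31 * X + 2) ^ e₁ *
  (X ^ 7 + 8760 * X ^ 6 - 13342 * X ^ 5 + 8388 * X ^ 4 - 2784 * X ^ 3 + 514 * X ^ 2
    - 50 * X + 2) ^ e₂

theorem P4OfExponents_eq_prodPoly (e₀ e₁ e₂ : ℕ) :
    P4OfExponents e₀ e₁ e₂ =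
      prodPoly (List.zip [e₂, e₁, e₀] coeffs4) := by
  rw [P4OfExponents, coeffs4]
  refine mul_pow_eq_prodPoly_cons ?_ (by simp [toPoly]; ring)
  refine mul_pow_eq_prodPoly_cons ?_ (by simp [toPoly]; ring)
  exact pow_eq_prodPoly_singleton (by simp [toPoly])

theorem P4_eq_prodPoly : P4 = prodPoly factors4 := by
  have h : P4 = P4OfExponents 640 47 35 := by
    exact Eq.refl P4
  rw [h, P4OfExponents_eq_prodPoly, factors4]

/-- The polynomial `P5` with arbitrary exponents, so that large powers are not unfolded. -/
noncomputable def P5OfExponents (e₀ e₁ e₂ : ℕ) : ℤ[X] :=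
  X ^ e₀ *
  (X ^ 10 + 5544095 * X ^ 9 - 9115714 * X ^ 8 + 6623719 * X ^ 7 - 2790988 * X ^ 6
    + 751349 * X ^ 5 - 133974 * X ^ 4 + 15818 * X ^ 3 - 1192 * X ^ 2 + 52 * X - 1) ^ e₁ *
  (X ^ 6 + 4950 * X ^ 5 - 4605 * X ^ 4 + 1698 * X ^ 3 - 310 * X ^ 2 + 28 * X - 1) ^ e₂

theorem P5OfExponents_eq_prodPoly (e₀ e₁ e₂ : ℕ) :
    P5OfExponents e₀ e₁ e₂ =
      prodPoly (List.zip [e₂, e₁, e₀] coeffs5) := by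
  rw [P5OfExponents, coeffs5]
  refine mul_pow_eq_prodPoly_cons ?_ (by simp [toPoly]; ring)
  refine mul_pow_eq_prodPoly_cons ?_ (by simp [toPoly]; ring)
  exact pow_eq_prodPoly_singleton (by simp [toPoly])

theorem P5_eq_prodPoly : P5 = prodPoly factors5 := by
  have h : P5 = P5OfExponents 1050990 78796 21825 := by
    exact Eq.refl P5
  rw [h, P5OfExponents_eq_prodPoly, factors5]

/-- The polynomial `P6` with arbitrary exponents, so that large powers are not unfolded. -/
noncomputable def P6OfExponents (e₀ e₁ e₂ : ℕ) : ℤ[X] :=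
  X ^ e₀ *
  (X ^ 5 + 1260 * X ^ 4 - 852 * X ^ 3 + 215 * X ^ 2 - 24 * X + 1) ^ e₁ *
  (X ^ 7 - 140190 * X ^ 6 + 132517 * X ^ 5 - 51966 * X ^ 4 + 10819 * X ^ 3 - 1261 * X ^ 2
    + 78 * X - 2) ^ e₂

theorem P6OfExponents_eq_prodPoly (e₀ e₁ e₂ : ℕ) :
    P6OfExponents e₀ e₁ e₂ =
      prodPoly (List.zip [e₂, e₁, e₀] coeffs6) := by
  rw [P6OfExponents, coeffs6]
  refine mul_pow_eq_prodPoly_cons ?_ (by simp [toPoly]; ring)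
  refine mul_pow_eq_prodPoly_cons ?_ (by simp [toPoly]; ring)
  exact pow_eq_prodPoly_singleton (by simp [toPoly])

theorem P6_eq_prodPoly : P6 = prodPoly factors6 := by
  have h : P6 = P6OfExponents 5232473 118824 200917 := by
    exact Eq.refl P6
  rw [h, P6OfExponents_eq_prodPoly, factors6]

theorem P7_eq_prodPoly : P7 = prodPoly factors7 := by
  -- The second factor has no written exponent, so the power 1 is supplied to match the list format.
  rw [P7, ← pow_one (X ^ 5 + _ - _ + _ - _ + 1)]
  exact mul_pow_eq_prodPoly_cons (pow_eq_prodPoly_singleton (by simp [toPoly]))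
    (by simp [toPoly]; ring)

/-- The polynomial `P8` with arbitrary exponents, so that large powers are not unfolded. -/
noncomputable def P8OfExponents (e₀ e₁ e₂ : ℕ) : ℤ[X] :=
  X ^ e₀ *
  (X ^ 2 - 8 * X + 1) ^ e₁ *
  (X ^ 4 - 576 * X ^ 3 + 208 * X ^ 2 - 25 * X + 1) ^ e₂

theorem P8OfExponents_eq_prodPoly (e₀ e₁ e₂ : ℕ) :
    P8OfExponents e₀ e₁ e₂ =
      prodPoly (List.zip [e₂, e₁, e₀] coeffs8) := by
  rw [P8OfExponents, coeffs8]
  refine mul_pow_eq_prodPoly_cons ?_ (by simp [toPoly]; ring)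
  refine mul_pow_eq_prodPoly_cons ?_ (by simp [toPoly]; ring)
  exact pow_eq_prodPoly_singleton (by simp [toPoly])

theorem P8_eq_prodPoly : P8 = prodPoly factors8 := by
  have h : P8 = P8OfExponents 12288 246 741 := by
    exact Eq.refl P8
  rw [h, P8OfExponents_eq_prodPoly, factors8]

end MonicDiameter

theorem mainTheorem5 :
    (MonicDiameter.AttainsMaximalObstruction MonicDiameter.P3 (Set.Ico 0 0.465) (1 / 3) ∧
      MonicDiameter.AttainsMaximalObstruction MonicDiameter.P4 (Set.Ico 0 0.303) (1 / 4) ∧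
      MonicDiameter.AttainsMaximalObstruction MonicDiameter.P5 (Set.Ico 0 0.230) (1 / 5) ∧
      MonicDiameter.AttainsMaximalObstruction MonicDiameter.P6 (Set.Ico 0 0.184) (1 / 6) ∧
      MonicDiameter.AttainsMaximalObstruction MonicDiameter.P7 (Set.Ico 0 0.148) (1 / 7) ∧
      MonicDiameter.AttainsMaximalObstruction MonicDiameter.P8 (Set.Ico 0 0.130) (1 / 8)) ∧
    (0.465 ≤ MonicDiameter.bMax 3 ∧
      0.303 ≤ MonicDiameter.bMax 4 ∧
      0.230 ≤ MonicDiameter.bMax 5 ∧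
      0.184 ≤ MonicDiameter.bMax 6 ∧
      0.148 ≤ MonicDiameter.bMax 7 ∧
      0.130 ≤ MonicDiameter.bMax 8) := by
  -- In each case m and D are chosen with b = 2m/D, here 0.465 = 186/400.
  obtain ⟨h3, hb3⟩ := MonicDiameter.attains_and_le_bMax (n := 3) (m := 93) (D := 400)
    (b := 0.465) (by norm_num) (by norm_num) (by norm_num) (by norm_num) (by norm_num)
    (by norm_num) (by norm_num) (by decide) (by decide)
    MonicDiameter.localCheck_factors3 MonicDiameter.cover_factors3
    MonicDiameter.P3_eq_prodPoly
  obtain ⟨h4, hb4⟩ := MonicDiameter.attains_and_le_bMax (n := 4) (m := 303) (D := 2000)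
    (b := 0.303) (by norm_num) (by norm_num) (by norm_num) (by norm_num) (by norm_num)
    (by norm_num) (by norm_num) (by decide) (by decide)
    MonicDiameter.localCheck_factors4 MonicDiameter.cover_factors4
    MonicDiameter.P4_eq_prodPoly
  obtain ⟨h5, hb5⟩ := MonicDiameter.attains_and_le_bMax (n := 5) (m := 23) (D := 200)
    (b := 0.230) (by norm_num) (by norm_num) (by norm_num) (by norm_num) (by norm_num)
    (by norm_num) (by norm_num) (by decide) (by decide)
    MonicDiameter.localCheck_factors5 MonicDiameter.cover_factors5
    MonicDiameter.P5_eq_prodPoly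
  obtain ⟨h6, hb6⟩ := MonicDiameter.attains_and_le_bMax (n := 6) (m := 23) (D := 250)
    (b := 0.184) (by norm_num) (by norm_num) (by norm_num) (by norm_num) (by norm_num)
    (by norm_num) (by norm_num) (by decide) (by decide)
    MonicDiameter.localCheck_factors6 MonicDiameter.cover_factors6
    MonicDiameter.P6_eq_prodPoly
  obtain ⟨h7, hb7⟩ := MonicDiameter.attains_and_le_bMax (n := 7) (m := 37) (D := 500)
    (b := 0.148) (by norm_num) (by norm_num) (by norm_num) (by norm_num) (by norm_num)
    (by norm_num) (by norm_num) (by decide) (by decide)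
    MonicDiameter.localCheck_factors7 MonicDiameter.cover_factors7
    MonicDiameter.P7_eq_prodPoly
  obtain ⟨h8, hb8⟩ := MonicDiameter.attains_and_le_bMax (n := 8) (m := 13) (D := 200)
    (b := 0.130) (by norm_num) (by norm_num) (by norm_num) (by norm_num) (by norm_num)
    (by norm_num) (by norm_num) (by decide) (by decide)
    MonicDiameter.localCheck_factors8 MonicDiameter.cover_factors8
    MonicDiameter.P8_eq_prodPoly
  exact ⟨⟨h3, h4, h5, h6, h7, h8⟩, hb3, hb4, hb5, hb6, hb7, hb8⟩
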